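/- Setting. A geodesic in a metric space $(X,d)$ is a map $\gamma\colon[a,b]\to X$ with $d(\gamma(t),\gamma(t'))=|t-t'|$ for all $t,t'\in[a,b]$, and a ray is a map $r\colon[0,\infty)\to X$ with the same property; it issues from $r(0)$. Let $X$ be a Hadamard space, that is, a complete metric space in which every two points are joined by a geodesic and such that $t\mapsto\frac12 d(\gamma(t),p)^2$ is $1$-strongly convex for every geodesic $\gamma$ and every $p\in X$. Assume that $X$ has at least two points and has the geodesic extension property: for all $x\ne y$ in $X$ some ray issuing from $x$ passes through $y$. The Busemann function of a ray $r$ is $b_r(z)=\lim_{t\to\infty}(d(z,r(t))-t)$. Two rays $r,r'$ are asymptotic if $\sup_{t\ge 0} d(r(t),r'(t))<\infty$; the boundary $X^\infty$ is the set of asymptoty classes of rays, and a ray has direction $\xi$ if it belongs to the class $\xi$. For $x\in X$ and $\xi\in X^\infty$ there is exactly one ray issuing from $x$ with direction $\xi$. Fix a reference point $\bar x\in X$ and let $b_\xi$ be the Busemann function of the ray issuing from $\bar x$ with direction $\xi$. The boundary cone $CX^\infty$ is the quotient of $X^\infty\times[0,\infty)$ that identifies all pairs $(\xi,0)$; the class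 of $(\xi,s)$ is written $[\xi,s]$, and $\langle x,[\xi,s]\rangle=s\,b_\xi(x)$, which is $0$ for $s=0$. A function $f\colon X\to\mathbb{R}$ is Busemann subdifferentiable if for every $x\in X$ there is $[\xi,s]\in CX^\infty$ such that $x$ minimizes $y\mapsto f(y)-\langle y,[\xi,s]\rangle$ over $X$. A subset $F$ of a metric space $Y$ is horospherically convex if it is closed and for each $x$ in the boundary of $F$ there is a ray $r$ in $Y$ issuing from $x$ with $F\subseteq\{z\in Y: b_r(z)\le 0\}$. The epigraph of $f$ is $\{(x,\alpha)\in X\times\mathbb{R}: f(x)\le\alpha\}$, where $X\times\mathbb{R}$ carries the metric $\sqrt{d(x,x')^2+|\alpha-\alpha'|^2}$. Proposition (Subdifferentiability, epigraphs and continuity). For a function $f\colon X\to\mathbb{R}$, consider the following conditions: (i) $f$ is Busemann subdifferentiable; (ii) the epigraph of $f$ is horospherically convex; (iii) $f$ is Busemann subdifferentiable and continuous. The implications (iii) $\Rightarrow$ (ii) $\Rightarrow$ (i) hold. If every closed ball of $X$ is compact, then all three conditions are equivalent. -/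

import Mathlib

open Filter Topology
open scoped NNReal

noncomputable section

namespace BusemannGeometry

/-! Geodesics, CAT(0) spaces and Hadamard spaces -/

/-- The restriction of `γ` to the closed interval `[a, b]` is a geodesic. -/
def IsGeodesicOn {X : Type*} [MetricSpace X] (γ : ℝ → X) (a b : ℝ) : Prop :=
  ∀ t ∈ Set.Icc a b, ∀ u ∈ Set.Icc a b, dist (γ t) (γ u) = |t - u|

/-- Every two points are joined by a geodesic. -/
def IsGeodesicSpace (X : Type*) [MetricSpace X] : Prop :=
  ∀ x y : X, ∃ (a b : ℝ) (γ : ℝ → X), a ≤ b ∧ IsGeodesicOn γ a b ∧ γ a = x ∧ γ b = y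

/-- A geodesic metric space is CAT(0) if half the squared distance to any point is
`1`-strongly convex along every geodesic. -/
def IsCATZero (X : Type*) [MetricSpace X] : Prop :=
  IsGeodesicSpace X ∧
    ∀ (a b : ℝ) (γ : ℝ → X), IsGeodesicOn γ a b →
      ∀ p : X, StrongConvexOn (Set.Icc a b) 1 (fun t => 1 / 2 * dist (γ t) p ^ 2)

/-- A Hadamard space is a complete CAT(0) space. -/
def IsHadamardSpace (X : Type*) [MetricSpace X] : Prop :=
  CompleteSpace X ∧ IsCATZero X

/-! Rays and Busemann functions -/

/-- A ray is a geodesic with domain `[0, ∞)`. -/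
structure Ray (X : Type*) [MetricSpace X] where
  toFun : ℝ≥0 → X
  isometry : Isometry toFun

instance {X : Type*} [MetricSpace X] : CoeFun (Ray X) (fun _ => ℝ≥0 → X) := ⟨Ray.toFun⟩

/-- For `x ≠ y` there is a ray issuing from `x` that passes through `y`. -/
def GeodesicExtensionProperty (X : Type*) [MetricSpace X] : Prop :=
  ∀ x y : X, x ≠ y → ∃ r : Ray X, r 0 = x ∧ ∃ t : ℝ≥0, 0 < t ∧ r t = y

/-- The Busemann function `b_r(z) = lim_{t → ∞} (d(z, r(t)) - t)`. -/
def busemann {X : Type*} [MetricSpace X] (r : Ray X) (z : X) : ℝ :=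
  limUnder atTop (fun t : ℝ≥0 => dist z (r t) - (t : ℝ))

/-- The limit defining the Busemann function always exists. -/
theorem tendsto_busemann {X : Type*} [MetricSpace X] (r : Ray X) (z : X) :
    Tendsto (fun t : ℝ≥0 => dist z (r t) - (t : ℝ)) atTop (𝓝 (busemann r z)) := by
  have hanti : Antitone (fun t : ℝ≥0 => dist z (r t) - (t : ℝ)) := by
    intro t u htu
    have h1 := dist_triangle z (r t) (r u)
    have h2 : dist (r t) (r u) = (u : ℝ) - t := by
      rw [r.isometry.dist_eq, NNReal.dist_eq, abs_sub_comm, abs_of_nonneg]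
      exact sub_nonneg.2 (by exact_mod_cast htu)
    simp only
    linarith
  have hbdd : BddBelow (Set.range (fun t : ℝ≥0 => dist z (r t) - (t : ℝ))) := by
    refine ⟨-dist z (r 0), ?_⟩
    rintro _ ⟨t, rfl⟩
    have h1 := dist_triangle_left (r 0) (r t) z
    have h2 : dist (r 0) (r t) = (t : ℝ) := by
      rw [r.isometry.dist_eq, NNReal.dist_eq, abs_sub_comm, abs_of_nonneg] <;> simp
    simp only
    linarith
  exact tendsto_nhds_limUnder ⟨_, tendsto_atTop_ciInf hanti hbdd⟩

/-! The boundary at infinity and the boundary cone -/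

/-- Two rays are asymptotic if they stay at bounded distance from each other. -/
def Asymptotic {X : Type*} [MetricSpace X] (r r' : Ray X) : Prop :=
  ∃ K : ℝ, 0 ≤ K ∧ ∀ t : ℝ≥0, dist (r t) (r' t) ≤ K

instance asymptoticSetoid (X : Type*) [MetricSpace X] : Setoid (Ray X) where
  r := Asymptotic
  iseqv :=
    { refl := fun r => ⟨0, le_rfl, fun t => by simp⟩
      symm := by
        rintro r s ⟨K, hK, h⟩
        exact ⟨K, hK, fun t => by rw [dist_comm]; exact h t⟩
      trans := by
        rintro r s u ⟨K, hK, h⟩ ⟨L, hL, h2⟩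
        exact ⟨K + L, add_nonneg hK hL, fun t =>
          (dist_triangle _ (s t) _).trans (add_le_add (h t) (h2 t))⟩ }

/-- The boundary at infinity: asymptoty classes of rays. -/
def Boundary (X : Type*) [MetricSpace X] : Type _ := Quotient (asymptoticSetoid X)

/-- The direction `r(∞)` of a ray `r`. -/
def Ray.direction {X : Type*} [MetricSpace X] (r : Ray X) : Boundary X :=
  Quotient.mk (asymptoticSetoid X) r

open Classical in
/-- The ray issuing from `x` with direction `ξ`. In a Hadamard space there is exactly one such
ray; the `else` branch is only there to make the definition total on all metric spaces. -/
def rayFrom {X : Type*} [MetricSpace X] (x : X) (ξ : Boundary X) : Ray X :=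
  if h : ∃ r : Ray X, r 0 = x ∧ r.direction = ξ then h.choose else Quotient.out ξ

/-- The relation on `X^∞ × [0, ∞)` that collapses all pairs with second entry `0`. -/
instance coneSetoid (X : Type*) [MetricSpace X] : Setoid (Boundary X × ℝ≥0) where
  r p q := (p.2 = 0 ∧ q.2 = 0) ∨ p = q
  iseqv :=
    { refl := fun p => Or.inr rfl
      symm := by
        rintro p q (⟨h, h2⟩ | h)
        · exact Or.inl ⟨h2, h⟩
        · exact Or.inr h.symm
      trans := by
        rintro p q u (⟨h, h2⟩ | rfl) (⟨h3, h4⟩ | rfl)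
        · exact Or.inl ⟨h, h4⟩
        · exact Or.inl ⟨h, h2⟩
        · exact Or.inl ⟨h3, h4⟩
        · exact Or.inr rfl }

/-- The boundary cone `CX^∞`, whose elements are the classes `[ξ, s]`. -/
def BoundaryCone (X : Type*) [MetricSpace X] : Type _ := Quotient (coneSetoid X)

/-- The pairing `⟨z, [ξ, s]⟩ = s * b_ξ(z)` (which is `0` for `s = 0`), where `b_ξ` is the Busemann
function of the ray issuing from the reference point `x₀` with direction `ξ`. -/
def pairing {X : Type*} [MetricSpace X] (x₀ z : X) : BoundaryCone X → ℝ :=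
  Quotient.lift (fun p : Boundary X × ℝ≥0 => (p.2 : ℝ) * busemann (rayFrom x₀ p.1) z) (by
    rintro p q (⟨h, h2⟩ | rfl)
    · simp [h, h2]
    · rfl)

/-! Busemann subgradients, horospherical convexity and epigraphs -/

/-- `c` is a Busemann subgradient at `x` of the restriction of `f` to `C`: the point `x` minimizes
`y ↦ f(y) - ⟨y, c⟩` over `C`. -/
def IsBusemannSubgradientOn {X : Type*} [MetricSpace X] (x₀ : X) (f : X → ℝ) (C : Set X)
    (x : X) (c : BoundaryCone X) : Prop :=
  IsMinOn (fun y => f y - pairing x₀ y c) C x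

/-- The restriction of `f` to `C` has a Busemann subgradient at every point of `C`. -/
def BusemannSubdifferentiableOn {X : Type*} [MetricSpace X] (x₀ : X) (f : X → ℝ)
    (C : Set X) : Prop :=
  ∀ x ∈ C, ∃ c : BoundaryCone X, IsBusemannSubgradientOn x₀ f C x c

/-- `F` is closed, and at each boundary point `x` of `F` there is a ray `r` issuing from `x` whose
horoball `{z | b_r(z) ≤ 0}` contains `F`. -/
def HorosphericallyConvex {Y : Type*} [MetricSpace Y] (F : Set Y) : Prop :=
  IsClosed F ∧ ∀ x ∈ frontier F, ∃ r : Ray Y, r 0 = x ∧ F ⊆ {z | busemann r z ≤ 0}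

/-- The epigraph of `f`, in `X × ℝ` with the `ℓ²` product metric. -/
def epigraph {X : Type*} [MetricSpace X] (f : X → ℝ) : Set (WithLp 2 (X × ℝ)) :=
  {p | f p.fst ≤ p.snd}

end BusemannGeometry

end

namespace BusemannGeometry

/-! ### Comparison inequalities in CAT(0) spaces. -/

variable {X : Type*} [MetricSpace X]

/-! A ray in `X × ℝ` has components of constant speeds `a ≥ 0` and `σ` with `a² + σ² = 1`, and if it
issues from `(x, f x)` its horoball is `a * b_r(y) ≤ σ * (β - f x)`. When `σ > 0`, containing the
epigraph means exactly that `f y ≥ f x + (a / σ) * b_r(y)`, a Busemann subgradient of slope `a / σ`;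
conversely a slope `s` gives the ray with speeds proportional to `(s, 1)`. The rays may issue from
`x` rather than from the reference point because Busemann functions of asymptotic rays differ by a
constant (`exists_asymptotic_ray`).

Geodesic extension lets every Busemann function grow at unit speed from every point
(`exists_busemann_ge`). This excludes `σ ≤ 0` for non-vertical rays. In proper spaces it also bounds
slopes locally: a steep subgradient at `y` forces a large value of `f` at one of finitely many net
points. Bounded slopes give continuity. -/

theorem dist_sq_le_of_isCATZero (hX : IsCATZero X) {γ : ℝ → X} {L : ℝ} (hL : 0 ≤ L)
    (hγ : IsGeodesicOn γ 0 L) (p : X) {l : ℝ} (h0 : 0 ≤ l) (h1 : l ≤ 1) :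
    dist (γ (l * L)) p ^ 2 ≤
      (1 - l) * dist (γ 0) p ^ 2 + l * dist (γ L) p ^ 2 - l * (1 - l) * L ^ 2 := by
  have h := (hX.2 0 L γ hγ p).2 (Set.left_mem_Icc.2 hL) (Set.right_mem_Icc.2 hL)
    (sub_nonneg.2 h1) h0 (by ring)
  simp only [smul_eq_mul, mul_zero, zero_add, zero_sub, norm_neg, Real.norm_eq_abs, sq_abs] at h
  linarith

theorem dist_le_of_isCATZero (hX : IsCATZero X) {γ : ℝ → X} {L : ℝ} (hL : 0 ≤ L)
    (hγ : IsGeodesicOn γ 0 L) (p : X) {l : ℝ} (h0 : 0 ≤ l) (h1 : l ≤ 1) :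
    dist (γ (l * L)) p ≤ (1 - l) * dist (γ 0) p + l * dist (γ L) p := by
  have h := dist_sq_le_of_isCATZero hX hL hγ p h0 h1
  have hd : dist (γ 0) (γ L) = L := by
    rw [hγ _ (Set.left_mem_Icc.2 hL) _ (Set.right_mem_Icc.2 hL), zero_sub, abs_neg,
      abs_of_nonneg hL]
  have h2 : |dist (γ 0) p - dist (γ L) p| ≤ L :=
    (abs_dist_sub_le (γ 0) (γ L) p).trans_eq hd
  have h3 : (dist (γ 0) p - dist (γ L) p) ^ 2 ≤ L ^ 2 := sq_le_sq' (abs_le.1 h2).1 (abs_le.1 h2).2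
  have h4 : 0 ≤ l * (1 - l) := mul_nonneg h0 (sub_nonneg.2 h1)
  refine abs_le_of_sq_le_sq' ?_ ?_ |>.2
  -- Replacing `L²` by the smaller squared difference of the end distances completes the square.
  · nlinarith [mul_le_mul_of_nonneg_left h3 h4]
  · have := mul_nonneg (sub_nonneg.2 h1) (dist_nonneg (x := γ 0) (y := p))
    have := mul_nonneg h0 (dist_nonneg (x := γ L) (y := p))
    linarith

theorem exists_geodesic (hX : IsGeodesicSpace X) (x y : X) :
    ∃ γ : ℝ → X, IsGeodesicOn γ 0 (dist x y) ∧ γ 0 = x ∧ γ (dist x y) = y := by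
  obtain ⟨a, b, γ, hab, hγ, rfl, rfl⟩ := hX x y
  have hd : dist (γ a) (γ b) = b - a := by
    rw [hγ _ (Set.left_mem_Icc.2 hab) _ (Set.right_mem_Icc.2 hab), abs_sub_comm,
      abs_of_nonneg (sub_nonneg.2 hab)]
  refine ⟨fun t => γ (a + t), ?_, by simp, by simp [hd]⟩
  rw [hd]
  intro t ht u hu
  rw [hγ _ ⟨by linarith [ht.1], by linarith [ht.2]⟩ _ ⟨by linarith [hu.1], by linarith [hu.2]⟩]
  congr 1; ring

/-- Two geodesics that end at the same point converge linearly to it. -/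
theorem dist_le_of_common_endpoint (hX : IsCATZero X) {γ γ' : ℝ → X} {L L' : ℝ} (hL : 0 ≤ L)
    (hL' : 0 ≤ L') (hγ : IsGeodesicOn γ 0 L) (hγ' : IsGeodesicOn γ' 0 L') (he : γ L = γ' L')
    {l : ℝ} (h0 : 0 ≤ l) (h1 : l ≤ 1) :
    dist (γ (l * L)) (γ' (l * L')) ≤ (1 - l) * dist (γ 0) (γ' 0) := by
  have hA : dist (γ 0) (γ L) = L := by
    rw [hγ _ (Set.left_mem_Icc.2 hL) _ (Set.right_mem_Icc.2 hL), zero_sub, abs_neg,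
      abs_of_nonneg hL]
  have hB : dist (γ L) (γ' (l * L')) = (1 - l) * L' := by
    rw [he, hγ' _ (Set.right_mem_Icc.2 hL') _ ⟨by positivity, by nlinarith⟩, abs_of_nonneg]
    · ring
    · nlinarith
  have e1 := dist_sq_le_of_isCATZero hX hL hγ (γ' (l * L')) h0 h1
  have e2 := dist_sq_le_of_isCATZero hX hL' hγ' (γ 0) h0 h1
  rw [← he, dist_comm (γ L) (γ 0), hA, dist_comm (γ' 0), dist_comm _ (γ 0)] at e2
  rw [hB] at e1
  refine abs_le_of_sq_le_sq' ?_ (mul_nonneg (sub_nonneg.2 h1) dist_nonneg) |>.2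
  -- In `e1 + (1 - l) * e2` all terms in `L` and `L'` cancel.
  nlinarith [mul_le_mul_of_nonneg_left e2 (sub_nonneg.2 h1)]

/-! Rays and their Busemann functions -/

theorem Ray.dist_eq (r : Ray X) (t u : ℝ≥0) : dist (r t) (r u) = |(t : ℝ) - u| := by
  rw [r.isometry.dist_eq, NNReal.dist_eq]

theorem Ray.isGeodesicOn (r : Ray X) (L : ℝ) : IsGeodesicOn (fun t => r t.toNNReal) 0 L := by
  intro t ht u hu
  simp only
  rw [r.dist_eq, Real.coe_toNNReal _ ht.1, Real.coe_toNNReal _ hu.1]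

theorem busemann_le_add_dist (r : Ray X) (y z : X) : busemann r y ≤ busemann r z + dist y z :=
  le_of_tendsto_of_tendsto' (tendsto_busemann r y) ((tendsto_busemann r z).add_const _)
    fun t => by linarith [dist_triangle y z (r t)]

theorem continuous_busemann (r : Ray X) : Continuous (busemann r) :=
  (LipschitzWith.of_le_add (busemann_le_add_dist r)).continuous

theorem busemann_apply (r : Ray X) (t : ℝ≥0) : busemann r (r t) = -t := by
  refine tendsto_nhds_unique (tendsto_busemann r (r t)) (tendsto_const_nhds.congr' ?_)
  filter_upwards [eventually_ge_atTop t] with u hu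
  rw [r.dist_eq, abs_sub_comm, abs_of_nonneg (sub_nonneg.2 (by exact_mod_cast hu))]
  ring

theorem busemann_le_of_isCATZero (hX : IsCATZero X) (r : Ray X) {γ : ℝ → X} {L : ℝ} (hL : 0 ≤ L)
    (hγ : IsGeodesicOn γ 0 L) {l : ℝ} (h0 : 0 ≤ l) (h1 : l ≤ 1) :
    busemann r (γ (l * L)) ≤ (1 - l) * busemann r (γ 0) + l * busemann r (γ L) :=
  le_of_tendsto_of_tendsto' (tendsto_busemann r _)
    (((tendsto_busemann r _).const_mul _).add ((tendsto_busemann r _).const_mul _))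
    fun t => by linarith [dist_le_of_isCATZero hX hL hγ (r t) h0 h1]

/-- Distinct rays with the same origin are not asymptotic. -/
theorem Ray.eq_of_asymptotic (hX : IsCATZero X) {r r' : Ray X} (h0 : r 0 = r' 0)
    (h : Asymptotic r r') (t : ℝ≥0) : r t = r' t := by
  obtain ⟨K, hK, h⟩ := h
  rw [← dist_le_zero]
  have key : ∀ᶠ T : ℝ in atTop, dist (r t) (r' t) ≤ t * K / T := by
    filter_upwards [eventually_gt_atTop (0 : ℝ), eventually_ge_atTop (t : ℝ)] with T hT htT
    -- Reversing time from `T` turns the common origin into a common endpoint, so the bound `K` at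
    -- time `T` shrinks by the factor `t / T`.
    have hrev : ∀ q : Ray X, IsGeodesicOn (fun s => q (T - s).toNNReal) 0 T := by
      intro q s hs u hu
      simp only
      rw [q.isGeodesicOn T _ ⟨by linarith [hs.2], by linarith [hs.1]⟩ _
        ⟨by linarith [hu.2], by linarith [hu.1]⟩, abs_sub_comm]
      congr 1; ring
    have := dist_le_of_common_endpoint hX hT.le hT.le (hrev r) (hrev r') (by simpa using h0)
      (l := 1 - t / T) (by rw [sub_nonneg, div_le_one hT]; exact htT) (by simp; positivity)
    have e : T - (1 - t / T) * T = t := by field_simp; ring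
    simp only [e, Real.toNNReal_coe, sub_zero, sub_sub_cancel] at this
    refine this.trans ?_
    rw [mul_div_right_comm]
    exact mul_le_mul_of_nonneg_left (h _) (by positivity)
  exact ge_of_tendsto (tendsto_const_nhds.div_atTop tendsto_id) key

/-- For a point `x` and a ray `r` there is a ray issuing from `x` asymptotic to `r`; its Busemann
function differs from that of `r` by a constant. -/
theorem exists_asymptotic_ray (hX : IsHadamardSpace X) (r : Ray X) (x : X) :
    ∃ c : Ray X, c 0 = x ∧ Asymptotic c r ∧ ∀ z, busemann c z = busemann r z - busemann r x := by
  obtain ⟨hcomp, hC⟩ := hX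
  set b := busemann r with hb
  set L : ℕ → ℝ := fun n => dist x (r n) with hL
  have hL0 : ∀ n, 0 ≤ L n := fun n => dist_nonneg
  have hnat : Tendsto (fun n : ℕ => (n : ℝ≥0)) atTop atTop := tendsto_natCast_atTop_atTop
  have hlim : ∀ z, Tendsto (fun n : ℕ => dist z (r n) - (n : ℝ)) atTop (𝓝 (b z)) := fun z => by
    simpa [Function.comp_def] using (tendsto_busemann r z).comp hnat
  have hLtop : Tendsto L atTop atTop := by
    have := (hlim x).add_atTop (tendsto_natCast_atTop_atTop (R := ℝ))
    simpa [hL] using this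
  choose c hc hc0 hcL using fun n : ℕ => exists_geodesic hC.1 x (r n)
  -- The ray is the limit of the geodesics from `x` to `r n`. By convexity and `b (r n) = -n`, `b`
  -- falls along them at nearly unit speed, as `L n - n → b x`.
  have hbc : ∀ t : ℝ≥0, ∃ ε : ℕ → ℝ, Tendsto ε atTop (𝓝 0) ∧
      ∀ᶠ n in atTop, b (c n t) ≤ b x - t + ε n := by
    intro t
    refine ⟨fun n => t * (L n - n - b x) / L n, ?_, ?_⟩
    · exact (((hlim x).sub_const (b x)).const_mul _).div_atTop hLtop
    · filter_upwards [hLtop.eventually_gt_atTop 0, hLtop.eventually_ge_atTop (t : ℝ)] with n hn hnt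
      have := busemann_le_of_isCATZero hC r (hL0 n) (hc n) (l := t / L n) (by positivity)
        ((div_le_one hn).2 hnt)
      rw [div_mul_cancel₀ _ hn.ne', hc0, hcL, busemann_apply] at this
      refine this.trans_eq ?_
      push_cast
      field_simp
      ring
  have hcx : ∀ t : ℝ≥0, ∀ᶠ n in atTop, dist (c n t) x = t := by
    intro t
    filter_upwards [hLtop.eventually_ge_atTop (t : ℝ)] with n hn
    have := hc n t ⟨t.2, hn⟩ 0 ⟨le_rfl, hL0 n⟩
    rwa [hc0, sub_zero, NNReal.abs_eq] at this
  have hcauchy : ∀ t : ℝ≥0, CauchySeq fun n => c n t := by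
    intro t
    obtain ⟨ε, hε, hbε⟩ := hbc t
    rw [Metric.cauchySeq_iff]
    intro δ hδ
    -- The midpoint of `c m t` and `c n t` has `b`-value below `b x - t + e`, hence lies at distance
    -- at least `t - e` from `x`; strong convexity then gives `dist² ≤ 8te < δ²`.
    have he : 0 < δ ^ 2 / (8 * (t + 1)) := by positivity
    obtain ⟨N, hN⟩ := eventually_atTop.1
      ((hε.eventually (gt_mem_nhds he)).and (hbε.and (hcx t)))
    refine ⟨N, fun m hm n hn => ?_⟩
    obtain ⟨hm1, hm2, hm3⟩ := hN m hm
    obtain ⟨hn1, hn2, hn3⟩ := hN n hn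
    obtain ⟨γ, hγ, hγ0, hγ1⟩ := exists_geodesic hC.1 (c m t) (c n t)
    have e1 := dist_sq_le_of_isCATZero hC dist_nonneg hγ x (l := 1 / 2) (by norm_num) (by norm_num)
    have e2 := busemann_le_of_isCATZero hC r dist_nonneg hγ (l := 1 / 2) (by norm_num)
      (by norm_num)
    rw [hγ0, hγ1] at e1 e2
    set p := γ (1 / 2 * dist (c m t) (c n t))
    have e3 := busemann_le_add_dist r x p
    rw [dist_comm] at e3
    set e := δ ^ 2 / (8 * (t + 1))
    have e4 : (t : ℝ) - e ≤ dist p x := by linarith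
    rw [hm3, hn3] at e1
    have e5 : (t : ℝ) ^ 2 - 2 * t * e ≤ dist p x ^ 2 := by
      have ht : (0 : ℝ) ≤ t := t.2
      rcases le_total e t with h | h
      · nlinarith
      · nlinarith [sq_nonneg (dist p x)]
    have e6 : e * (8 * (t + 1)) = δ ^ 2 := div_mul_cancel₀ _ (by positivity)
    refine lt_of_pow_lt_pow_left₀ 2 hδ.le ?_
    linarith
  choose d hd using fun t => cauchySeq_tendsto_of_complete (hcauchy t)
  have hiso : Isometry d := by
    refine Isometry.of_dist_eq fun t u => ?_
    refine tendsto_nhds_unique ((hd t).dist (hd u)) (tendsto_const_nhds.congr' ?_)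
    filter_upwards [hLtop.eventually_ge_atTop (t : ℝ), hLtop.eventually_ge_atTop (u : ℝ)]
      with n hn hn'
    rw [hc n t ⟨t.2, hn⟩ u ⟨u.2, hn'⟩, NNReal.dist_eq]
  have hbd : ∀ t : ℝ≥0, b (d t) ≤ b x - t := by
    intro t
    obtain ⟨ε, hε, hbε⟩ := hbc t
    have := le_of_tendsto_of_tendsto (((continuous_busemann r).tendsto _).comp (hd t))
      (hε.const_add (b x - t)) hbε
    simpa using this
  -- Comparing `c n` and `r` at the same fraction `t / L n` costs one `dist x (r 0)`, and correcting
  -- the parameter along `r` costs another.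
  have hasym : ∀ t : ℝ≥0, dist (d t) (r t) ≤ 2 * dist x (r 0) := by
    intro t
    refine le_of_tendsto ((hd t).dist tendsto_const_nhds) ?_
    filter_upwards [hLtop.eventually_gt_atTop 0, hLtop.eventually_ge_atTop (t : ℝ)] with n hn hnt
    have hl0 : 0 ≤ t / L n := by positivity
    have hl1 : t / L n ≤ 1 := (div_le_one hn).2 hnt
    have h1 := dist_le_of_common_endpoint hC (hL0 n) (Nat.cast_nonneg n) (hc n) (r.isGeodesicOn n)
      (by rw [hcL]; simp) hl0 hl1
    rw [div_mul_cancel₀ _ hn.ne', hc0] at h1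
    simp only [Real.toNNReal_zero] at h1
    have h2 : dist (r (t / L n * n).toNNReal) (r t) ≤ dist x (r 0) := by
      rw [r.dist_eq, Real.coe_toNNReal _ (by positivity)]
      have h3 : t / L n * n - t = t / L n * ((n : ℝ) - L n) := by field_simp
      have h4 : |(n : ℝ) - L n| ≤ dist x (r 0) := by
        have h5 : dist (r 0) (r n) = n := by rw [r.dist_eq]; simp
        have := abs_dist_sub_le (r 0) x (r n)
        rwa [h5, dist_comm (r 0) x] at this
      rw [h3, abs_mul, abs_of_nonneg hl0]
      exact (mul_le_of_le_one_left (abs_nonneg _) hl1).trans h4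
    have h6 := dist_triangle (c n t) (r (t / L n * n).toNNReal) (r t)
    have h7 : (1 - t / L n) * dist x (r 0) ≤ dist x (r 0) :=
      mul_le_of_le_one_left dist_nonneg (by linarith)
    linarith
  -- Limit of strong convexity at the fraction `t / L n`, using `dist² - L² = (dist - L) * ((dist -
  -- L) + 2L)`.
  have hsq : ∀ (z : X) (t : ℝ≥0),
      dist z (d t) ^ 2 ≤ dist z x ^ 2 + t ^ 2 + 2 * t * (b z - b x) := by
    intro z t
    have hdiff : Tendsto (fun n : ℕ => dist z (r n) - L n) atTop (𝓝 (b z - b x)) := by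
      refine ((hlim z).sub (hlim x)).congr fun n => ?_
      simp [hL]
    have hR := (hdiff.mul ((hdiff.div_atTop hLtop).add_const 2)).const_mul (t : ℝ)
    have := le_of_tendsto_of_tendsto (((tendsto_const_nhds (x := z)).dist (hd t)).pow 2)
      (hR.const_add (dist z x ^ 2 + (t : ℝ) ^ 2)) (?_)
    · linarith
    filter_upwards [hLtop.eventually_gt_atTop 0, hLtop.eventually_ge_atTop (t : ℝ)] with n hn hnt
    have h1 := dist_sq_le_of_isCATZero hC (hL0 n) (hc n) z (l := t / L n) (by positivity)
      ((div_le_one hn).2 hnt)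
    rw [div_mul_cancel₀ _ hn.ne', hc0, hcL, dist_comm x z, dist_comm (r n) z, dist_comm _ z] at h1
    have h2 : 0 ≤ t / L n * dist z x ^ 2 := by positivity
    refine h1.trans (le_of_sub_nonneg (h2.trans_eq ?_))
    field_simp
    ring
  refine ⟨⟨d, hiso⟩, ?_, ⟨2 * dist x (r 0), by positivity, hasym⟩, fun z => le_antisymm ?_ ?_⟩
  · refine tendsto_nhds_unique (hd 0) (tendsto_const_nhds.congr fun n => ?_)
    simp [hc0]
  · have hB := tendsto_busemann ⟨d, hiso⟩ z
    have ht : Tendsto (fun t : ℝ≥0 => (t : ℝ)) atTop atTop := NNReal.tendsto_coe_atTop.2 tendsto_id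
    have h1 := hB.mul ((hB.div_atTop ht).add_const 2)
    have h2 : Tendsto (fun t : ℝ≥0 => dist z x ^ 2 / (t : ℝ) + 2 * (b z - b x)) atTop
        (𝓝 (0 + 2 * (b z - b x))) := (tendsto_const_nhds.div_atTop ht).add_const _
    have := le_of_tendsto_of_tendsto h1 h2 (?_)
    · linarith
    filter_upwards [eventually_gt_atTop 0] with t ht
    have ht' : (0 : ℝ) < t := ht
    have h3 := div_le_div_of_nonneg_right (sub_nonneg.2 (hsq z t)) ht'.le
    rw [zero_div] at h3
    refine le_of_sub_nonneg (h3.trans_eq ?_)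
    field_simp
    ring
  -- The reverse bound needs only that `b` is 1-Lipschitz and drops by at least `t` along `d`.
  · refine ge_of_tendsto' (tendsto_busemann ⟨d, hiso⟩ z) fun t => ?_
    have := busemann_le_add_dist r z (d t)
    linarith [hbd t]

theorem busemann_eq_of_asymptotic (hX : IsHadamardSpace X) {r r' : Ray X} (h : Asymptotic r r')
    (z : X) : busemann r z = busemann r' z - busemann r' (r 0) := by
  obtain ⟨c, hc0, hc, hb⟩ := exists_asymptotic_ray hX r' (r 0)
  have : c = r := by
    have := Ray.eq_of_asymptotic hX.2 hc0
      ((asymptoticSetoid X).trans hc ((asymptoticSetoid X).symm h))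
    cases c; cases r; congr; exact funext this
  rw [← hb, this]

/-- Each level of a Busemann function is left at unit speed along some geodesic. -/
theorem exists_busemann_ge (hX : IsHadamardSpace X) (hext : GeodesicExtensionProperty X)
    (r : Ray X) (x : X) : ∃ y, dist y x = 1 ∧ busemann r x + 1 ≤ busemann r y := by
  obtain ⟨c, rfl, -, hb⟩ := exists_asymptotic_ray hX r x
  have hne : dist (c 1) (c 0) = 1 := by rw [c.dist_eq]; simp
  -- Extending backwards from `c 1` through `c 0` makes `c 0` the midpoint of `c 1` and `q 2`;
  -- convexity forces the value at `q 2` to be at least `1`.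
  obtain ⟨q, hq0, t, -, hqt⟩ := hext (c 1) (c 0) (by rw [← dist_ne_zero, hne]; norm_num)
  have ht : t = 1 := by
    rw [← hq0, ← hqt, q.dist_eq] at hne
    simpa using hne
  subst ht
  refine ⟨q 2, by rw [← hqt, q.dist_eq]; norm_num, ?_⟩
  have := busemann_le_of_isCATZero hX.2 c (zero_le_two) (q.isGeodesicOn 2) (l := 1 / 2)
    (by norm_num) (by norm_num)
  norm_num [hq0] at this
  rw [hqt, busemann_apply, busemann_apply, hb (q 2)] at this
  push_cast at this
  linarith

/-! Rays in the product `X × ℝ` -/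

theorem dist_sq_withLp (p q : WithLp 2 (X × ℝ)) :
    dist p q ^ 2 = dist p.fst q.fst ^ 2 + (p.snd - q.snd) ^ 2 := by
  rw [WithLp.prod_dist_eq_add (by norm_num), ENNReal.toReal_ofNat, Real.dist_eq p.snd,
    ← Real.sqrt_eq_rpow, Real.sq_sqrt (by positivity)]
  norm_num

/-- The Busemann function of a ray in `X × ℝ` whose components have speeds `a` and `σ`. -/
theorem busemann_withLp (ρ : Ray (WithLp 2 (X × ℝ))) {a σ ℓ : ℝ} (ha : a ^ 2 + σ ^ 2 = 1)
    (hσ : ∀ t : ℝ≥0, (ρ t).snd = (ρ 0).snd + σ * t) (p : WithLp 2 (X × ℝ))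
    (hℓ : Tendsto (fun t : ℝ≥0 => dist p.fst (ρ t).fst - a * t) atTop (𝓝 ℓ)) :
    busemann ρ p = a * ℓ - σ * (p.snd - (ρ 0).snd) := by
  have ht : Tendsto (fun t : ℝ≥0 => (t : ℝ)) atTop atTop := NNReal.tendsto_coe_atTop.2 tendsto_id
  have hB := tendsto_busemann ρ p
  -- `(d - t) * ((d - t) / t + 2) = (d² - t²) / t` expresses the limit through squared distances,
  -- which add over the factors.
  have h1 := hB.mul ((hB.div_atTop ht).add_const 2)
  have h2 := ((hℓ.mul ((hℓ.div_atTop ht).add_const (2 * a))).sub_const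
    (2 * σ * (p.snd - (ρ 0).snd))).add
    ((tendsto_const_nhds (x := (p.snd - (ρ 0).snd) ^ 2)).div_atTop ht)
  have := tendsto_nhds_unique_of_eventuallyEq h1 h2 ?_
  · linarith
  filter_upwards [eventually_gt_atTop 0] with t ht
  have ht' : (0 : ℝ) < t := ht
  have h := dist_sq_withLp p (ρ t)
  rw [hσ t] at h
  field_simp
  linear_combination h + (t : ℝ) ^ 2 * ha

/-- The components of a ray in `X × ℝ` have constant speed. -/
theorem Ray.exists_speed (ρ : Ray (WithLp 2 (X × ℝ))) : ∃ a σ : ℝ, 0 ≤ a ∧ a ^ 2 + σ ^ 2 = 1 ∧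
    (∀ t u : ℝ≥0, dist (ρ t).fst (ρ u).fst = a * |(t : ℝ) - u|) ∧
    ∀ t : ℝ≥0, (ρ t).snd = (ρ 0).snd + σ * t := by
  have hsq : ∀ t u : ℝ≥0, ((t : ℝ) - u) ^ 2 =
      dist (ρ t).fst (ρ u).fst ^ 2 + ((ρ t).snd - (ρ u).snd) ^ 2 := fun t u => by
    rw [← dist_sq_withLp, ρ.dist_eq, sq_abs]
  -- equality in the triangle inequality forces the component vectors to be parallel
  have hpar : ∀ t u : ℝ≥0, t ≤ u →
      t * ((ρ u).snd - (ρ t).snd) = ((u : ℝ) - t) * ((ρ t).snd - (ρ 0).snd) := by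
    intro t u htu
    have h1 := hsq 0 t
    have h2 := hsq t u
    have h3 := hsq 0 u
    have h4 := dist_triangle (ρ 0).fst (ρ t).fst (ρ u).fst
    have htu' : (t : ℝ) ≤ u := htu
    have ht : (0 : ℝ) ≤ t := t.2
    have d0 : 0 ≤ dist (ρ 0).fst (ρ u).fst := dist_nonneg
    generalize dist (ρ 0).fst (ρ t).fst = A at *
    generalize dist (ρ t).fst (ρ u).fst = B at *
    generalize dist (ρ 0).fst (ρ u).fst = C at *
    have h5 : C ^ 2 ≤ (A + B) ^ 2 := pow_le_pow_left₀ d0 h4 2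
    rw [← sub_eq_zero, ← sq_eq_zero_iff]
    refine le_antisymm ?_ (sq_nonneg _)
    push_cast at h1 h2 h3
    have h6 := mul_nonneg (mul_nonneg ht (sub_nonneg.2 htu')) (sub_nonneg.2 h5)
    have h7 := sq_nonneg (t * B - ((u : ℝ) - t) * A)
    linear_combination h6 + h7 + ((t : ℝ) * u - u ^ 2) * h1 - (t : ℝ) * u * h2 + (t * (u - t)) * h3
  have hsnd : ∀ t : ℝ≥0, (ρ t).snd = (ρ 0).snd + ((ρ 1).snd - (ρ 0).snd) * t := by
    intro t
    rcases le_total t 1 with h | h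
    · have := hpar t 1 h
      push_cast at this
      linarith
    · have := hpar 1 t h
      push_cast at this
      linarith
  have h1 := hsq 0 1
  refine ⟨dist (ρ 0).fst (ρ 1).fst, (ρ 1).snd - (ρ 0).snd, dist_nonneg, ?_, fun t u => ?_, hsnd⟩
  · norm_num at h1
    linarith
  · rw [← abs_of_nonneg (dist_nonneg (x := (ρ 0).fst) (y := (ρ 1).fst)), ← abs_mul,
      ← abs_of_nonneg (dist_nonneg (x := (ρ t).fst)), ← sq_eq_sq_iff_abs_eq_abs]
    have h2 := hsq t u
    rw [hsnd t, hsnd u] at h2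
    push_cast at h1
    linear_combination (t - u : ℝ) ^ 2 * h1 - h2

/-- The ray in `X × ℝ` whose components are a reparametrized ray and a line. -/
theorem Ray.exists_lift (r : Ray X) (α : ℝ) {a σ : ℝ} (ha0 : 0 ≤ a) (ha : a ^ 2 + σ ^ 2 = 1) :
    ∃ ρ : Ray (WithLp 2 (X × ℝ)), ρ 0 = WithLp.toLp 2 (r 0, α) ∧
      ∀ p, busemann ρ p = a * busemann r p.fst - σ * (p.snd - α) := by
  lift a to ℝ≥0 using ha0
  have hiso : Isometry fun t : ℝ≥0 => WithLp.toLp 2 (r (a * t), α + σ * t) := by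
    refine Isometry.of_dist_eq fun t u => ?_
    rw [← abs_of_nonneg dist_nonneg, ← abs_of_nonneg (dist_nonneg (x := t)),
      ← sq_eq_sq_iff_abs_eq_abs, dist_sq_withLp, NNReal.dist_eq, sq_abs]
    simp only [WithLp.toLp_fst, WithLp.toLp_snd, r.dist_eq, sq_abs]
    push_cast
    linear_combination (t - u : ℝ) ^ 2 * ha
  refine ⟨⟨_, hiso⟩, by simp, fun p => ?_⟩
  rcases eq_zero_or_pos a with rfl | ha0
  · have := busemann_withLp ⟨_, hiso⟩ ha (fun t => by simp) p
      (tendsto_const_nhds (x := dist p.fst (r 0)) |>.congr fun t => by simp)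
    simpa using this
  have hat : Tendsto (fun t : ℝ≥0 => a * t) atTop atTop := tendsto_id.const_mul_atTop ha0
  have := busemann_withLp ⟨_, hiso⟩ ha (fun t => by simp) p
    (((tendsto_busemann r p.fst).comp hat).congr fun t => by simp)
  simpa using this

/-- A ray in `X × ℝ` that is not vertical projects to a ray in `X`. -/
theorem Ray.exists_proj (ρ : Ray (WithLp 2 (X × ℝ))) {a σ : ℝ} (ha0 : 0 < a)
    (ha : a ^ 2 + σ ^ 2 = 1)
    (hd : ∀ t u : ℝ≥0, dist (ρ t).fst (ρ u).fst = a * |(t : ℝ) - u|)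
    (hσ : ∀ t : ℝ≥0, (ρ t).snd = (ρ 0).snd + σ * t) :
    ∃ r : Ray X, r 0 = (ρ 0).fst ∧
      ∀ p, busemann ρ p = a * busemann r p.fst - σ * (p.snd - (ρ 0).snd) := by
  lift a to ℝ≥0 using ha0.le
  have ha1 : (a : ℝ) ≠ 0 := ha0.ne'
  have hiso : Isometry fun t : ℝ≥0 => (ρ (t / a)).fst := by
    refine Isometry.of_dist_eq fun t u => ?_
    rw [hd, NNReal.dist_eq]
    push_cast
    rw [← sub_div, abs_div, NNReal.abs_eq]
    field_simp
  refine ⟨⟨_, hiso⟩, by simp, fun p => busemann_withLp ρ ha hσ p ?_⟩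
  have hat : Tendsto (fun t : ℝ≥0 => a * t) atTop atTop :=
    tendsto_id.const_mul_atTop (by exact_mod_cast ha0)
  refine ((tendsto_busemann ⟨_, hiso⟩ p.fst).comp hat).congr fun t => ?_
  simp [mul_div_cancel_left₀ t (NNReal.coe_ne_zero.1 ha1)]

/-- The Busemann function of a vertical ray. -/
theorem busemann_withLp_vertical (ρ : Ray (WithLp 2 (X × ℝ))) {σ : ℝ} (ha : σ ^ 2 = 1)
    (hd : ∀ t u : ℝ≥0, dist (ρ t).fst (ρ u).fst = 0)
    (hσ : ∀ t : ℝ≥0, (ρ t).snd = (ρ 0).snd + σ * t) (p : WithLp 2 (X × ℝ)) :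
    busemann ρ p = -σ * (p.snd - (ρ 0).snd) := by
  have := busemann_withLp ρ (a := 0) (by simpa using ha) hσ p
    (tendsto_const_nhds (x := dist p.fst (ρ 0).fst) |>.congr fun t => by
      rw [dist_eq_zero.1 (hd t 0)]; simp)
  rw [this]; ring

/-! Busemann subgradients -/

theorem direction_rayFrom (x : X) (ξ : Boundary X) : (rayFrom x ξ).direction = ξ := by
  unfold rayFrom
  split_ifs with h
  · exact h.choose_spec.2
  · exact Quotient.out_eq ξ

theorem asymptotic_rayFrom_direction (x : X) (r : Ray X) :
    Asymptotic r (rayFrom x r.direction) :=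
  (asymptoticSetoid X).symm (Quotient.exact (direction_rayFrom x r.direction))

theorem BusemannSubdifferentiableOn.exists_ray {x₀ : X} {f : X → ℝ}
    (hf : BusemannSubdifferentiableOn x₀ f Set.univ) (x : X) :
    ∃ (s : ℝ≥0) (r : Ray X), ∀ y, f x + s * (busemann r y - busemann r x) ≤ f y := by
  obtain ⟨c, hc⟩ := hf x (Set.mem_univ x)
  induction c using Quotient.inductionOn with
  | h p =>
    refine ⟨p.2, rayFrom x₀ p.1, fun y => ?_⟩
    have : f x - p.2 * busemann (rayFrom x₀ p.1) x ≤ f y - p.2 * busemann (rayFrom x₀ p.1) y :=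
      hc (Set.mem_univ y)
    linarith

/-- Moving the ray to the reference point changes its Busemann function by a constant, which does
not affect minimizers. -/
theorem exists_isBusemannSubgradientOn (hX : IsHadamardSpace X) (x₀ : X) {f : X → ℝ} {x : X}
    {r : Ray X} (s : ℝ≥0) (hr : r 0 = x) (h : ∀ y, f x + s * busemann r y ≤ f y) :
    ∃ c, IsBusemannSubgradientOn x₀ f Set.univ x c := by
  refine ⟨Quotient.mk _ (r.direction, s), fun y _ => ?_⟩
  have hy := busemann_eq_of_asymptotic hX (asymptotic_rayFrom_direction x₀ r) y
  have := h y
  rw [hy, hr] at this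
  show f x - s * busemann (rayFrom x₀ r.direction) x ≤
    f y - s * busemann (rayFrom x₀ r.direction) y
  linarith

/-! ### Subgradients and horoballs supporting the epigraph. -/

theorem horosphericallyConvex_epigraph (hX : IsHadamardSpace X) {x₀ : X} {f : X → ℝ}
    (hf : BusemannSubdifferentiableOn x₀ f Set.univ) (hc : Continuous f) :
    HorosphericallyConvex (epigraph f) := by
  have h1 : Continuous fun p : WithLp 2 (X × ℝ) => f p.fst :=
    hc.comp (continuous_fst.comp (WithLp.prod_continuous_ofLp 2 X ℝ))
  have h2 : Continuous fun p : WithLp 2 (X × ℝ) => p.snd :=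
    continuous_snd.comp (WithLp.prod_continuous_ofLp 2 X ℝ)
  refine ⟨isClosed_le h1 h2, fun p hp => ?_⟩
  have hp : f p.fst = p.snd := frontier_le_subset_eq h1 h2 hp
  obtain ⟨s, r, hs⟩ := hf.exists_ray p.fst
  obtain ⟨q, hq0, -, hq⟩ := exists_asymptotic_ray hX r p.fst
  have hn : 0 < √(1 + (s : ℝ) ^ 2) := by positivity
  have hn2 : √(1 + (s : ℝ) ^ 2) ^ 2 = 1 + (s : ℝ) ^ 2 := Real.sq_sqrt (by positivity)
  set n := √(1 + (s : ℝ) ^ 2)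
  -- The speeds are `(s, 1)` normalized to length one.
  obtain ⟨ρ, hρ0, hρ⟩ := q.exists_lift p.snd (a := s / n) (σ := 1 / n) (by positivity) (by
    field_simp
    linarith)
  refine ⟨ρ, by rw [hρ0, hq0]; rfl, fun z hz => ?_⟩
  have hz : f z.fst ≤ z.snd := hz
  have h3 := hs z.fst
  rw [← hq, hp] at h3
  show busemann ρ z ≤ 0
  rw [hρ, div_mul_eq_mul_div, div_mul_eq_mul_div, ← sub_div, one_mul]
  exact div_nonpos_of_nonpos_of_nonneg (by linarith) hn.le

theorem mem_frontier_epigraph (f : X → ℝ) (x : X) :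
    WithLp.toLp 2 (x, f x) ∈ frontier (epigraph f) := by
  refine ⟨subset_closure (le_refl (f x)), fun h => ?_⟩
  obtain ⟨ε, hε, hb⟩ := Metric.mem_nhds_iff.1 (mem_interior_iff_mem_nhds.1 h)
  have : WithLp.toLp 2 (x, f x - ε / 2) ∈ epigraph f := by
    refine hb (lt_of_pow_lt_pow_left₀ 2 hε.le ?_)
    rw [dist_sq_withLp]
    simp
    nlinarith
  have : f x ≤ f x - ε / 2 := this
  linarith

theorem busemannSubdifferentiableOn_of_epigraph [Nontrivial X] (hX : IsHadamardSpace X)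
    (hext : GeodesicExtensionProperty X) (x₀ : X) {f : X → ℝ}
    (hf : HorosphericallyConvex (epigraph f)) :
    BusemannSubdifferentiableOn x₀ f Set.univ := by
  intro x _
  obtain ⟨ρ, hρ0, hρ⟩ := hf.2 _ (mem_frontier_epigraph f x)
  obtain ⟨a, σ, ha0, ha, hd, hσ⟩ := ρ.exists_speed
  have hx : (ρ 0).fst = x := by rw [hρ0]; rfl
  have hfx : (ρ 0).snd = f x := by rw [hρ0]; rfl
  have hle : ∀ y β, f y ≤ β → busemann ρ (WithLp.toLp 2 (y, β)) ≤ 0 := fun y β h => hρ h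
  rcases ha0.eq_or_lt with rfl | ha0
  · have hb : ∀ y β, f y ≤ β → -σ * (β - f x) ≤ 0 := fun y β h => by
      have := hle y β h
      rwa [busemann_withLp_vertical ρ (by simpa using ha) (by simpa using hd) hσ, hfx] at this
    obtain ⟨y, hy⟩ := exists_ne x
    obtain ⟨r, hr, -⟩ := hext x y hy.symm
    refine exists_isBusemannSubgradientOn hX x₀ 0 hr fun y => ?_
    -- The epigraph is unbounded upwards, so a vertical ray must point up; then `x` minimizes `f`
    -- and slope `0` works with any ray.
    have h1 := hb x (f x + 1) (by linarith)
    have h2 : σ = 1 := by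
      rcases sq_eq_sq_iff_eq_or_eq_neg.1 (show σ ^ 2 = 1 ^ 2 by simpa using ha) with h | h
      · exact h
      · norm_num [h] at h1
    have := hb y (f y) le_rfl
    rw [h2] at this
    simp
    linarith
  · obtain ⟨r, hr, hb⟩ := ρ.exists_proj ha0 ha hd hσ
    have hb : ∀ y β, f y ≤ β → a * busemann r y ≤ σ * (β - f x) := fun y β h => by
      have := hle y β h
      rw [hb, hfx] at this
      exact sub_nonpos.1 this
    have hσ0 : 0 < σ := by
      obtain ⟨y, -, hy⟩ := exists_busemann_ge hX hext r (r 0)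
      rw [busemann_apply, NNReal.coe_zero, neg_zero, zero_add] at hy
      -- Here `b_r(y) ≥ 1` and the height is at least `f x`, so `σ ≤ 0` would contradict `a > 0`.
      have := hb y (max (f y) (f x)) (le_max_left _ _)
      by_contra! h
      nlinarith [le_max_right (f y) (f x)]
    refine exists_isBusemannSubgradientOn hX x₀ (a / σ).toNNReal (hr.trans hx) fun y => ?_
    have := hb y (f y) le_rfl
    rw [Real.coe_toNNReal _ (by positivity), div_mul_eq_mul_div]
    have := (div_le_iff₀' hσ0).2 this
    linarith

/-! ### Continuity in proper spaces. -/

theorem continuous_of_busemannSubdifferentiableOn [ProperSpace X] (hX : IsHadamardSpace X)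
    (hext : GeodesicExtensionProperty X) {x₀ : X} {f : X → ℝ}
    (hf : BusemannSubdifferentiableOn x₀ f Set.univ) : Continuous f := by
  rw [continuous_iff_continuousAt]
  intro x
  -- No upper bound for `f` on the ball is known yet, so `f` is bounded on a finite `1/2`-net.
  -- Passing from `z` to a net point keeps more than `1/2` of the unit gain of `b_{r'}`, whence the
  -- factor `2` in `K`.
  obtain ⟨T, -, hTfin, hT⟩ :=
    (isCompact_closedBall x 2).finite_cover_balls (e := 1 / 2) (by norm_num)
  obtain ⟨M, hM⟩ := (hTfin.image f).bddAbove
  obtain ⟨s, r, hs⟩ := hf.exists_ray x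
  have hlow : ∀ y, f x - s * dist y x ≤ f y := fun y => by
    have := mul_le_mul_of_nonneg_left (busemann_le_add_dist r x y) s.2
    rw [dist_comm] at this
    simp only [NNReal.val_eq_coe] at this
    linarith [hs y]
  -- near `x` the slopes of the subgradients are uniformly bounded
  set K := 2 * (M - f x + s)
  have hup : ∀ y, dist y x ≤ 1 → f y - K * dist y x ≤ f x := fun y hy => by
    obtain ⟨s', r', hs'⟩ := hf.exists_ray y
    obtain ⟨z, hz, hbz⟩ := exists_busemann_ge hX hext r' y
    have hzx : z ∈ Metric.closedBall x 2 := by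
      rw [Metric.mem_closedBall]
      linarith [dist_triangle z y x]
    obtain ⟨w, hw, hwz⟩ := Set.mem_iUnion₂.1 (hT hzx)
    have hwM : f w ≤ M := hM ⟨w, hw, rfl⟩
    have hwz : dist z w < 1 / 2 := hwz
    have h1 := busemann_le_add_dist r' z w
    have h2 : (s' : ℝ) * (1 / 2) ≤ s' * (busemann r' w - busemann r' y) :=
      mul_le_mul_of_nonneg_left (by linarith) s'.2
    have h3 : (s : ℝ) * dist y x ≤ s := mul_le_of_le_one_right s.2 hy
    have h4 : (s' : ℝ) ≤ K := by linarith [hs' w, hlow y]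
    have h5 := mul_le_mul_of_nonneg_left (busemann_le_add_dist r' y x) s'.2
    simp only [NNReal.val_eq_coe] at h5
    have h6 := mul_le_mul_of_nonneg_right h4 (dist_nonneg (x := y) (y := x))
    linarith [hs' x]
  have hd : Tendsto (fun y => dist y x) (𝓝 x) (𝓝 0) := by
    simpa using (continuous_id.dist (continuous_const (y := x))).tendsto x
  refine tendsto_of_tendsto_of_tendsto_of_le_of_le' (g := fun y => f x - s * dist y x)
    (h := fun y => f x + K * dist y x) ?_ ?_ (Eventually.of_forall hlow) ?_
  · simpa using (hd.const_mul (s : ℝ)).const_sub (f x)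
  · simpa using (hd.const_mul K).const_add (f x)
  · filter_upwards [Metric.closedBall_mem_nhds x one_pos] with y hy
    linarith [hup y hy]

end BusemannGeometry

theorem mainTheorem10 {X : Type*} [MetricSpace X] [Nontrivial X]
    (hX : BusemannGeometry.IsHadamardSpace X)
    (hext : BusemannGeometry.GeodesicExtensionProperty X)
    (x₀ : X) (f : X → ℝ) :
    ((BusemannGeometry.BusemannSubdifferentiableOn x₀ f Set.univ ∧ Continuous f →
        BusemannGeometry.HorosphericallyConvex (BusemannGeometry.epigraph f)) ∧
      (BusemannGeometry.HorosphericallyConvex (BusemannGeometry.epigraph f) →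
        BusemannGeometry.BusemannSubdifferentiableOn x₀ f Set.univ)) ∧
    (ProperSpace X →
      List.TFAE [
        BusemannGeometry.BusemannSubdifferentiableOn x₀ f Set.univ,
        BusemannGeometry.HorosphericallyConvex (BusemannGeometry.epigraph f),
        BusemannGeometry.BusemannSubdifferentiableOn x₀ f Set.univ ∧ Continuous f]) := by
  have h32 : BusemannGeometry.BusemannSubdifferentiableOn x₀ f Set.univ ∧ Continuous f →
      BusemannGeometry.HorosphericallyConvex (BusemannGeometry.epigraph f) :=
    fun h => BusemannGeometry.horosphericallyConvex_epigraph hX h.1 h.2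
  have h21 := BusemannGeometry.busemannSubdifferentiableOn_of_epigraph (f := f) hX hext x₀
  refine ⟨⟨h32, h21⟩, fun _ => ?_⟩
  tfae_have 3 → 2 := h32
  tfae_have 2 → 1 := h21
  tfae_have 1 → 3 := fun h =>
    ⟨h, BusemannGeometry.continuous_of_busemannSubdifferentiableOn hX hext h⟩
  tfae_finish
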